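/- Let $(R,\mathfrak m)$ be a commutative Noetherian local ring; all modules are finitely generated. The depth of the zero module is $\infty$. Call $R$ Gorenstein if it has finite injective dimension over itself. Call a Cohen–Macaulay local ring $R$ almost Gorenstein (in the sense of Goto–Takahashi–Taniguchi) if $R$ has a canonical module $\omega$ (a maximal Cohen–Macaulay module of type $1$ and of finite injective dimension) and there is an exact sequence of $R$-modules $0\to R\to\omega\to C\to 0$ such that $\mu_R(C)=e^0_{\mathfrak m}(C)$. Here $\mu_R(C)$ is the minimal number of generators of $C$, and $e^0_{\mathfrak m}(C)=\lim_{n\to\infty} s!\,\ell_R(C/\mathfrak m^nC)/n^s$ with $s=\dim C$ is the multiplicity of $C$ with respect to $\mathfrak m$, which is $0$ if $C=0$. Say that $R$ satisfies $(ES^R_1)$ if every $R$-module $X$ with $\operatorname{Ext}^i_R(X,R)=0$ for all $i>0$ satisfies $(\widetilde{S_1})$, that is, $\operatorname{depth} X_{\mathfrak p}\ge\min\{1,\operatorname{depth} R_{\mathfrak p}\}$ for every prime ideal $\mathfrak p$ of $R$. **Corollary 4.6 (partial Auslander–Reiten conjecture).** Let $R$ be an almost Gorenstein Cohen–Macaulay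 local ring that is not Gorenstein, and assume that $R$ satisfies $(ES^R_1)$. Let $M$ be an $R$-module with $\operatorname{Ext}^i_R(M,R)=0$ for all $i>0$. Then $M$ is free. -/

import Mathlib

open CategoryTheory Abelian RingTheory.Sequence Filter Topology

universe u

namespace LocalAlg

/-- The depth of a finitely generated module `M` over a Noetherian local ring `(R, 𝔪)`: the supremum
of the lengths of `M`-sequences in `𝔪`. For `M ≠ 0` finitely generated, weakly regular sequences in
`𝔪` are regular by Nakayama's lemma; for `M = 0` one gets the usual convention `depth 0 = ∞`. -/
noncomputable def depth (R : Type*) [CommRing R] [IsLocalRing R]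
    (M : Type*) [AddCommGroup M] [Module R M] : ℕ∞ :=
  ⨆ (rs : List R) (_ : IsWeaklyRegular M rs) (_ : ∀ r ∈ rs, r ∈ IsLocalRing.maximalIdeal R),
    (rs.length : ℕ∞)

/-- A Noetherian local ring is Cohen–Macaulay if its depth equals its Krull dimension. -/
def IsCohenMacaulay (R : Type*) [CommRing R] [IsLocalRing R] : Prop :=
  ((depth R R : ℕ∞) : WithBot ℕ∞) = ringKrullDim R

/-- A (finitely generated) module is maximal Cohen–Macaulay if its depth is `dim R`. -/
def IsMaximalCohenMacaulay (R : Type*) [CommRing R] [IsLocalRing R]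
    (M : Type*) [AddCommGroup M] [Module R M] : Prop :=
  ((depth R M : ℕ∞) : WithBot ℕ∞) = ringKrullDim R

/-- `Ext^{i}_R(M, N) = 0` for all `i > 0`. -/
def ExtPosVanishes (R : Type u) [CommRing R] (M N : Type u)
    [AddCommGroup M] [Module R M] [AddCommGroup N] [Module R N] : Prop :=
  ∀ i : ℕ, 0 < i → Subsingleton (Ext (ModuleCat.of R M) (ModuleCat.of R N) i)

/-- The injective dimension of `M` over `R` is finite. -/
def FiniteInjectiveDimension (R : Type u) [CommRing R]
    (M : Type u) [AddCommGroup M] [Module R M] : Prop :=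
  ∃ n : ℕ, HasInjectiveDimensionLT (ModuleCat.of R M) n

/-- A Noetherian local ring is Gorenstein if it has finite injective dimension over itself. -/
def IsGorenstein (R : Type u) [CommRing R] : Prop :=
  FiniteInjectiveDimension R R

/-- The (Cohen–Macaulay) type `dim_k Ext^t_R(k, M)`, with `t = depth M` and `k` the residue field.
The module `Ext^t_R(k, M)` is killed by the maximal ideal, so its length over `R` is its dimension
over `k`. -/
noncomputable def cmType (R : Type u) [CommRing R] [IsLocalRing R]
    (M : Type u) [AddCommGroup M] [Module R M] : ℕ∞ :=
  Module.length R
    (Ext (ModuleCat.of R (IsLocalRing.ResidueField R)) (ModuleCat.of R M) (depth R M).toNat)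

/-- A canonical module of a Cohen–Macaulay local ring: a finitely generated maximal Cohen–Macaulay
module of type one and of finite injective dimension. -/
structure IsCanonicalModule (R : Type u) [CommRing R] [IsLocalRing R]
    (ω : Type u) [AddCommGroup ω] [Module R ω] : Prop where
  finite : Module.Finite R ω
  maximalCohenMacaulay : IsMaximalCohenMacaulay R ω
  type_one : cmType R ω = 1
  finiteInjectiveDimension : FiniteInjectiveDimension R ω

/-- The multiplicity of the finitely generated module `M` with respect to the maximal ideal `𝔪` is
`e`, i.e. `e = lim_n s! · ℓ(M / 𝔪ⁿ M) / n ^ s`, where `s = dim M` (and `e = 0` for `M = 0`). -/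
def HasMultiplicity (R : Type*) [CommRing R] [IsLocalRing R]
    (M : Type*) [AddCommGroup M] [Module R M] (e : ℝ) : Prop :=
  let s : ℕ := ((Module.supportDim R M).unbotD 0).toNat
  Tendsto (fun n : ℕ ↦ (s.factorial : ℝ) *
      ((Module.length R (M ⧸ (IsLocalRing.maximalIdeal R ^ n • (⊤ : Submodule R M)))).toNat : ℝ) /
        (n : ℝ) ^ s) atTop (𝓝 e)

/-- An almost Gorenstein local ring in the sense of Goto–Takahashi–Taniguchi (for a
Cohen–Macaulay local ring `R`): `R` has a canonical module `ω`, and there is an exact sequence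
`0 → R → ω → C → 0` such that the minimal number of generators of `C` equals the multiplicity of
`C` with respect to the maximal ideal. -/
def IsAlmostGorenstein (R : Type u) [CommRing R] [IsLocalRing R] : Prop :=
  ∃ (ω : Type u) (_ : AddCommGroup ω) (_ : Module R ω)
    (C : Type u) (_ : AddCommGroup C) (_ : Module R C) (f : R →ₗ[R] ω) (g : ω →ₗ[R] C),
    IsCanonicalModule R ω ∧
    Function.Injective f ∧ Function.Exact f g ∧ Function.Surjective g ∧
    HasMultiplicity R C ((⊤ : Submodule R C).spanFinrank : ℝ)

/-- The condition `(S̃_n)`: `depth M_𝔭 ≥ min {n, depth R_𝔭}` for every prime ideal `𝔭`. -/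
def SatisfiesSTilde (R : Type*) [CommRing R] (M : Type*) [AddCommGroup M] [Module R M]
    (n : ℕ) : Prop :=
  ∀ (p : Ideal R) [p.IsPrime],
    min (n : ℕ∞) (depth (Localization.AtPrime p) (Localization.AtPrime p)) ≤
      depth (Localization.AtPrime p) (LocalizedModule p.primeCompl M)

/-- The condition `(ES^C_n)` on `R`: each finitely generated `R`-module `X` with
`Ext^{>0}_R(X, C) = 0` satisfies `(S̃_n)`. -/
def SatisfiesES (R : Type u) [CommRing R] (C : Type u) [AddCommGroup C] [Module R C]
    (n : ℕ) : Prop :=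
  ∀ (X : Type u) [AddCommGroup X] [Module R X], Module.Finite R X →
    ExtPosVanishes R X C → SatisfiesSTilde R X n

end LocalAlg

/-!
The cokernel `C` of `R → ω` is nonzero, as `R` is not Gorenstein, and it is an Ulrich module, that
is, Cohen–Macaulay with `e(C) = μ(C)`. Indeed `depth C ≥ dim R - 1` because `R` and `ω` have depth
`dim R`, and `dim C < dim R`: every endomorphism of `ω` is a homothety because `ω` has type one, so
`Hom(C, ω) = 0` and `C` is killed by an `ω`-regular element.

Let `Ext^{>0}(X, C) = 0`. Applying `Hom(-, C)` to a cover `0 → K → R^b → X → 0` gives an exact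
sequence `0 → Hom(X, C) → C^b → Hom(K, C) → 0`, and iterating shows that the outer terms have depth
at least `dim C`. For a module `H` with `dim C ≤ depth H`, the Hilbert–Samuel function of `H` grows
at least like `μ(H) · j ^ s / s!`, `s = dim C`, so `μ(Hom(X, C)) + μ(Hom(K, C)) ≤ e(C^b) = μ(C^b)`.
If all maps `X → C` have image in `𝔪C`, then `Hom(X, C) ⊆ 𝔪C^b`, hence `μ(Hom(K, C)) = μ(C^b)` and
`Hom(X, C) = 0`. This applies to the syzygy of `X` in a minimal cover, and a finitely generated
module all of whose `Ext`s into the nonzero module `C` vanish is zero: `X` is free.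

In the theorem, `Ext^i(M, C) = 0` for `i` large, since `ω` has finite injective dimension and
`Ext^{>0}(M, R) = 0`. So a high syzygy of `M` is free, and freeness descends along syzygies because
`Ext^1(-, R) = 0` splits the covers.
-/

namespace LocalAlg

section Ext

variable {R : Type u} [CommRing R]
  {A : Type u} [AddCommGroup A] [Module R A] {B : Type u} [AddCommGroup B] [Module R B]
  {C : Type u} [AddCommGroup C] [Module R C]

theorem shortExact_of_linearMap {f : A →ₗ[R] B} {g : B →ₗ[R] C} (hf : Function.Injective f)
    (hfg : Function.Exact f g) (hg : Function.Surjective g) :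
    (ModuleCat.shortComplexOfCompEqZero f g hfg.linearMap_comp_eq_zero).ShortExact where
  exact := ModuleCat.shortComplex_exact _ hfg
  mono_f := (ModuleCat.mono_iff_injective _).mpr hf
  epi_g := (ModuleCat.epi_iff_surjective _).mpr hg

theorem subsingleton_ext_right_of_exact {f : A →ₗ[R] B} {g : B →ₗ[R] C}
    (hf : Function.Injective f) (hfg : Function.Exact f g) (hg : Function.Surjective g)
    (X : ModuleCat.{u} R) (i : ℕ) (hB : Subsingleton (Ext X (ModuleCat.of R B) i))
    (hA : Subsingleton (Ext X (ModuleCat.of R A) (i + 1))) :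
    Subsingleton (Ext X (ModuleCat.of R C) i) := by
  refine subsingleton_of_forall_eq 0 fun x ↦ ?_
  obtain ⟨y, rfl⟩ := Ext.covariant_sequence_exact₃ X
    (shortExact_of_linearMap hf hfg hg) x rfl (hA.elim _ _)
  rw [hB.elim y 0, Ext.zero_comp]

theorem subsingleton_ext_left_of_exact {f : A →ₗ[R] B} {g : B →ₗ[R] C}
    (hf : Function.Injective f) (hfg : Function.Exact f g) (hg : Function.Surjective g)
    (X : ModuleCat.{u} R) (i : ℕ) (hC : Subsingleton (Ext X (ModuleCat.of R C) i))
    (hB : Subsingleton (Ext X (ModuleCat.of R B) (i + 1))) :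
    Subsingleton (Ext X (ModuleCat.of R A) (i + 1)) := by
  refine subsingleton_of_forall_eq 0 fun x ↦ ?_
  obtain ⟨y, rfl⟩ := Ext.covariant_sequence_exact₁ X
    (shortExact_of_linearMap hf hfg hg) x (hB.elim _ _) rfl
  rw [hC.elim y 0, Ext.zero_comp]

variable (A C) in
theorem subsingleton_ext_zero_iff :
    Subsingleton (Ext (ModuleCat.of R A) (ModuleCat.of R C) 0) ↔ Subsingleton (A →ₗ[R] C) :=
  (Ext.addEquiv₀.trans (ModuleCat.homAddEquiv (M := ModuleCat.of R A)
    (N := ModuleCat.of R C))).subsingleton_congr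

variable {F : Type u} [AddCommGroup F] [Module R F] [Module.Projective R F]

theorem subsingleton_ext_one_iff {p : F →ₗ[R] A} (hp : Function.Surjective p) :
    Subsingleton (Ext (ModuleCat.of R A) (ModuleCat.of R C) 1) ↔
      ∀ φ : LinearMap.ker p →ₗ[R] C, ∃ ψ : F →ₗ[R] C, ψ ∘ₗ (LinearMap.ker p).subtype = φ := by
  have hS := shortExact_of_linearMap (Submodule.subtype_injective _) p.exact_subtype_ker_map hp
  have : Projective (ModuleCat.of R F) := (IsProjective.iff_projective F).mp inferInstance
  constructor
  · intro h φ
    obtain ⟨y, hy⟩ := Ext.contravariant_sequence_exact₁ hS _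
      (Ext.mk₀ (ModuleCat.ofHom φ)) rfl (h.elim _ _)
    obtain ⟨ψ, rfl⟩ := (Ext.mk₀_bijective _ _).2 y
    rw [Ext.mk₀_comp_mk₀] at hy
    exact ⟨ψ.hom, congrArg ModuleCat.Hom.hom ((Ext.mk₀_bijective _ _).1 hy)⟩
  · intro h
    refine subsingleton_of_forall_eq 0 fun x ↦ ?_
    obtain ⟨y, rfl⟩ := Ext.contravariant_sequence_exact₃ hS _ x
      (Ext.eq_zero_of_projective (P := ModuleCat.of R F) _) (n₀ := 0) rfl
    obtain ⟨φ, rfl⟩ := (Ext.mk₀_bijective _ _).2 y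
    obtain ⟨ψ, hψ⟩ := h φ.hom
    have : φ = ModuleCat.ofHom (LinearMap.ker p).subtype ≫ ModuleCat.ofHom ψ := by
      rw [← ModuleCat.ofHom_comp, hψ]; rfl
    rw [this, ← Ext.mk₀_comp_mk₀]
    exact hS.extClass_comp_assoc _

theorem subsingleton_ext_add_two_iff {p : F →ₗ[R] A} (hp : Function.Surjective p) (i : ℕ) :
    Subsingleton (Ext (ModuleCat.of R A) (ModuleCat.of R C) (i + 2)) ↔
      Subsingleton (Ext (ModuleCat.of R (LinearMap.ker p)) (ModuleCat.of R C) (i + 1)) := by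
  have hS := shortExact_of_linearMap (Submodule.subtype_injective _) p.exact_subtype_ker_map hp
  have : Projective (ModuleCat.of R F) := (IsProjective.iff_projective F).mp inferInstance
  constructor <;> refine fun h ↦ subsingleton_of_forall_eq 0 fun x ↦ ?_
  · obtain ⟨y, rfl⟩ := Ext.contravariant_sequence_exact₁ hS _ x (n₁ := i + 2) (by omega)
      (h.elim _ _)
    rw [Ext.eq_zero_of_projective (P := ModuleCat.of R F) y, Ext.comp_zero]
  · obtain ⟨y, rfl⟩ := Ext.contravariant_sequence_exact₃ hS _ x
      (Ext.eq_zero_of_projective (P := ModuleCat.of R F) _) (n₀ := i + 1) (by omega)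
    rw [h.elim y 0, Ext.comp_zero]

theorem ExtPosVanishes.ker {p : F →ₗ[R] A} (h : ExtPosVanishes R A C)
    (hp : Function.Surjective p) : ExtPosVanishes R (LinearMap.ker p) C
  | i + 1, _ => (subsingleton_ext_add_two_iff hp i).mp (h (i + 2) (by omega))

theorem ExtPosVanishes.exists_extension {p : F →ₗ[R] A} (h : ExtPosVanishes R A C)
    (hp : Function.Surjective p) (φ : LinearMap.ker p →ₗ[R] C) :
    ∃ ψ : F →ₗ[R] C, ψ ∘ₗ (LinearMap.ker p).subtype = φ :=
  (subsingleton_ext_one_iff hp).mp (h 1 one_pos) φ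

end Ext

section Depth

open IsLocalRing

theorem exists_ringKrullDim_eq_natCast (R : Type*) [CommRing R] [IsLocalRing R]
    [IsNoetherianRing R] : ∃ d : ℕ, ringKrullDim R = d := by
  obtain ⟨d, hd⟩ := WithBot.ne_bot_iff_exists.mp (ringKrullDim_ne_bot (R := R))
  obtain ⟨d, rfl⟩ := ENat.ne_top_iff_exists.mp
    (fun ht ↦ ringKrullDim_ne_top (R := R) (by rw [← hd, ht]; rfl) : d ≠ ⊤)
  exact ⟨d, hd.symm⟩

variable {R : Type u} [CommRing R] [IsLocalRing R]

theorem maximalIdeal_smul_top_lt (M : Type*) [AddCommGroup M] [Module R M] [Module.Finite R M]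
    [Nontrivial M] : maximalIdeal R • (⊤ : Submodule R M) < ⊤ :=
  (Submodule.top_ne_ideal_smul_of_le_jacobson_annihilator
    (maximalIdeal_le_jacobson _)).symm.lt_top

theorem natCast_le_depth_iff_exists {M : Type*} [AddCommGroup M] [Module R M] {n : ℕ} :
    (n : ℕ∞) ≤ depth R M ↔
      ∃ rs : List R, n ≤ rs.length ∧ (∀ r ∈ rs, r ∈ maximalIdeal R) ∧ IsWeaklyRegular M rs := by
  constructor
  · intro h
    by_contra! hlt
    rcases n with _ | n
    · exact hlt [] le_rfl (by simp) (.nil _ _)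
    · have : depth R M ≤ n := iSup_le fun rs ↦ iSup_le fun h₁ ↦ iSup_le fun h₂ ↦ by
        by_contra! hn
        exact hlt rs (by exact_mod_cast Order.add_one_le_of_lt hn) h₂ h₁
      exact absurd (h.trans this) (by norm_cast; omega)
  · rintro ⟨rs, hn, hrs, h⟩
    exact (Nat.cast_le.mpr hn).trans (le_iSup_of_le rs (le_iSup_of_le h (le_iSup_of_le hrs le_rfl)))

theorem exists_isSMulRegular_of_one_le_depth {M : Type*} [AddCommGroup M] [Module R M]
    (h : 1 ≤ depth R M) : ∃ y ∈ maximalIdeal R, IsSMulRegular M y := by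
  obtain ⟨rs, hn, hrs, hr⟩ := (natCast_le_depth_iff_exists (n := 1)).mp (by exact_mod_cast h)
  rcases rs with _ | ⟨y, rs⟩
  · simp at hn
  · exact ⟨y, hrs y (by simp), ((isWeaklyRegular_cons_iff _ _ _).mp hr).1⟩

theorem depth_eq_top_of_subsingleton (M : Type*) [AddCommGroup M] [Module R M] [Subsingleton M] :
    depth R M = ⊤ :=
  ENat.eq_top_iff_forall_ge.mpr fun n ↦ natCast_le_depth_iff_exists.mpr
    ⟨List.replicate n 0, by simp, by simp +contextual [List.mem_replicate], ⟨fun i hi x y _ ↦ by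
      have : Subsingleton (QuotSMulTop (List.replicate n (0 : R))[i] M) := inferInstance
      exact Subsingleton.elim (α := _ ⧸ _) x y⟩⟩

variable {M : Type u} [AddCommGroup M] [Module R M] [Module.Finite R M]

theorem support_residueField :
    Module.support R (ResidueField R) = PrimeSpectrum.zeroLocus (maximalIdeal R) := by
  rw [Module.support_eq_zeroLocus]
  exact congrArg _ (congrArg _ Ideal.annihilator_quotient)

variable [IsNoetherianRing R]

theorem natCast_le_depth_iff {n : ℕ} : (n : ℕ∞) ≤ depth R M ↔ ∀ i < n,
    Subsingleton (Ext (ModuleCat.of R (ResidueField R)) (ModuleCat.of R M) i) := by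
  have : Module.Finite R (ModuleCat.of R (ResidueField R)) :=
    inferInstanceAs (Module.Finite R (ResidueField R))
  rcases subsingleton_or_nontrivial M with hM | hM
  · refine iff_of_true (by simp [depth_eq_top_of_subsingleton]) fun i _ ↦
      subsingleton_of_forall_eq 0 fun x ↦ ?_
    have : Limits.IsZero (ModuleCat.of R M) := ModuleCat.isZero_of_subsingleton _
    rw [← x.comp_mk₀_id, this.eq_of_src (𝟙 _) 0, Ext.mk₀_zero, Ext.comp_zero]
  have hlt := maximalIdeal_smul_top_lt (R := R) M
  rw [natCast_le_depth_iff_exists]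
  constructor
  · rintro ⟨rs, hn, hrs, h⟩ i hi
    exact ModuleCat.subsingleton_ext_of_exists_isRegular (maximalIdeal R) _
      support_residueField.subset (ModuleCat.of R M) hlt rs hrs
      ⟨h, fun he ↦ hlt.not_ge (he.le.trans (Submodule.smul_mono_left (Ideal.span_le.mpr hrs)))⟩ i
      (hi.trans_le hn)
  · intro h
    obtain ⟨rs, hn, hrs, hr⟩ := ModuleCat.exists_isRegular_of_exists_subsingleton_ext
      (maximalIdeal R) n (ModuleCat.of R M) hlt _ support_residueField h
    exact ⟨rs, hn.ge, hrs, hr.1⟩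

variable {A : Type u} [AddCommGroup A] [Module R A] [Module.Finite R A]
  {B : Type u} [AddCommGroup B] [Module R B] [Module.Finite R B]
  {C : Type u} [AddCommGroup C] [Module R C] [Module.Finite R C]
  {f : A →ₗ[R] B} {g : B →ₗ[R] C} {n : ℕ}

theorem le_depth_right_of_exact (hf : Function.Injective f) (hfg : Function.Exact f g)
    (hg : Function.Surjective g) (hA : (n + 1 : ℕ) ≤ depth R A) (hB : n ≤ depth R B) :
    n ≤ depth R C :=
  natCast_le_depth_iff.mpr fun i hi ↦ subsingleton_ext_right_of_exact hf hfg hg _ i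
    (natCast_le_depth_iff.mp hB i hi) (natCast_le_depth_iff.mp hA (i + 1) (by omega))

theorem le_depth_left_of_exact (hf : Function.Injective f) (hfg : Function.Exact f g)
    (hg : Function.Surjective g) (hB : (n + 1 : ℕ) ≤ depth R B) (hC : n ≤ depth R C) :
    (n + 1 : ℕ) ≤ depth R A := by
  refine natCast_le_depth_iff.mpr fun i hi ↦ ?_
  rcases i with _ | i
  · have := (subsingleton_ext_zero_iff _ _).mp (natCast_le_depth_iff.mp hB 0 n.succ_pos)
    exact (subsingleton_ext_zero_iff _ _).mpr (subsingleton_of_forall_eq 0 fun φ ↦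
      LinearMap.ext fun x ↦ hf (by simpa using LinearMap.congr_fun (this.elim (f ∘ₗ φ) 0) x))
  · exact subsingleton_ext_left_of_exact hf hfg hg _ i
      (natCast_le_depth_iff.mp hC i (by omega)) (natCast_le_depth_iff.mp hB (i + 1) hi)

theorem le_depth_quotSMulTop {y : R} (hy : IsSMulRegular M y) (h : (n + 1 : ℕ) ≤ depth R M) :
    n ≤ depth R (QuotSMulTop y M) :=
  le_depth_right_of_exact (f := LinearMap.lsmul R M y) hy (LinearMap.exact_lsmul_mkQ_smul_top M y)
    (Submodule.mkQ_surjective _) h ((Nat.cast_le.mpr n.le_succ).trans h)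

end Depth

section Length

open IsLocalRing

variable {R : Type*} [CommRing R]

theorem length_le_add_of_exact {A B C : Type*} [AddCommGroup A] [Module R A]
    [AddCommGroup B] [Module R B] [AddCommGroup C] [Module R C] {f : A →ₗ[R] B} {g : B →ₗ[R] C}
    (hfg : Function.Exact f g) : Module.length R B ≤ Module.length R A + Module.length R C := by
  rw [Module.length_eq_add_of_exact (LinearMap.ker g).subtype g.rangeRestrict
    (Submodule.subtype_injective _) g.surjective_rangeRestrict
    (by rw [LinearMap.exact_iff]; simp)]
  refine add_le_add ?_ (Module.length_le_of_injective _ (Submodule.subtype_injective _))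
  rw [LinearMap.exact_iff.mp hfg]
  exact Module.length_le_of_surjective f.rangeRestrict f.surjective_rangeRestrict

theorem length_ne_top_of_isArtinianRing_quotient (I : Ideal R) [IsArtinianRing (R ⧸ I)]
    (M : Type*) [AddCommGroup M] [Module R M] [Module.Finite R M] [Module (R ⧸ I) M]
    [IsScalarTower R (R ⧸ I) M] : Module.length R M ≠ ⊤ := by
  have : Module.Finite (R ⧸ I) M := Module.Finite.of_restrictScalars_finite R _ _
  rw [Module.length_eq_of_surjective (R := R ⧸ I) Ideal.Quotient.mk_surjective]
  exact Module.length_ne_top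

theorem length_ne_top_of_supportDim_le_zero [IsNoetherianRing R] {M : Type*} [AddCommGroup M]
    [Module R M] [Module.Finite R M] (h : Module.supportDim R M ≤ 0) : Module.length R M ≠ ⊤ := by
  rw [Module.supportDim_eq_ringKrullDim_quotient_annihilator] at h
  have : IsArtinianRing (R ⧸ Module.annihilator R M) :=
    isArtinianRing_iff_isNoetherianRing_krullDimLE_zero.mpr
      ⟨inferInstance, Ring.krullDimLE_iff.mpr (mod_cast h)⟩
  let _ : Module (R ⧸ Module.annihilator R M) M := Module.quotientAnnihilator
  have : IsScalarTower R (R ⧸ Module.annihilator R M) M := ⟨fun r s m ↦ by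
    obtain ⟨s, rfl⟩ := Ideal.Quotient.mk_surjective s
    exact mul_smul r s m⟩
  exact length_ne_top_of_isArtinianRing_quotient (Module.annihilator R M) M

variable [IsLocalRing R] {D : Type*} [AddCommGroup D] [Module R D]

theorem length_linearMap_le (hD : Module.length R (ResidueField R →ₗ[R] D) ≤ 1)
    {N : Type*} [AddCommGroup N] [Module R N] (hN : IsFiniteLength R N) :
    Module.length R (N →ₗ[R] D) ≤ Module.length R N := by
  induction hN with
  | of_subsingleton => simp [Module.length_eq_zero]
  | @of_simple_quotient N _ _ S hS _ ih =>
    have hquot : Module.length R ((N ⧸ S) →ₗ[R] D) ≤ 1 := by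
      obtain ⟨m, hm, ⟨e⟩⟩ := isSimpleModule_iff_quot_maximal.mp hS
      obtain rfl := IsLocalRing.eq_maximalIdeal hm
      exact (LinearEquiv.congrLeft D R e).length_eq.le.trans hD
    calc Module.length R (N →ₗ[R] D)
      _ ≤ Module.length R ((N ⧸ S) →ₗ[R] D) + Module.length R (S →ₗ[R] D) :=
        length_le_add_of_exact (LinearMap.exact_lcomp_of_exact_of_surjective D
          (LinearMap.exact_subtype_mkQ S) (Submodule.mkQ_surjective S))
      _ ≤ Module.length R (N ⧸ S) + Module.length R S := by
        rw [Module.length_eq_one R (N ⧸ S)]; gcongr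
      _ = Module.length R N := by
        rw [add_comm, Module.length_eq_add_of_exact S.subtype S.mkQ S.subtype_injective
          S.mkQ_surjective (LinearMap.exact_subtype_mkQ S)]

theorem surjective_algebraMap_end_of_length_ne_top
    (hD : Module.length R (ResidueField R →ₗ[R] D) ≤ 1) (hlen : Module.length R D ≠ ⊤) :
    Function.Surjective (algebraMap R (Module.End R D)) := by
  let H := LinearMap.range (Algebra.linearMap R (Module.End R D))
  have hEnd : Module.length R (Module.End R D) ≤ Module.length R D :=
    length_linearMap_le hD (Module.length_ne_top_iff.mp hlen)
  have hH : Module.length R H ≤ Module.length R (Module.End R D) :=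
    Module.length_le_of_injective H.subtype (Submodule.subtype_injective _)
  -- `D` is a quotient of `Hom(H, D)`, through evaluation at the identity
  have hDH : Module.length R D ≤ Module.length R H := by
    refine le_trans ?_ (length_linearMap_le hD (Module.length_ne_top_iff.mp
      (ne_top_of_le_ne_top hlen (hH.trans hEnd))))
    refine Module.length_le_of_surjective
      (LinearMap.applyₗ (⟨1, 1, map_one (algebraMap R (Module.End R D))⟩ : H)) fun d ↦ ?_
    exact ⟨LinearMap.applyₗ d ∘ₗ H.subtype, rfl⟩
  obtain ⟨_, _⟩ := isFiniteLength_iff_isNoetherian_isArtinian.mp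
    (Module.length_ne_top_iff.mp (ne_top_of_le_ne_top hlen hEnd))
  have htop : H = ⊤ := by
    by_contra hne
    exact (Submodule.length_lt hne).not_ge (hEnd.trans hDH)
  exact LinearMap.range_eq_top.mp htop

variable [IsNoetherianRing R] {M : Type*} [AddCommGroup M] [Module R M] [Module.Finite R M]

theorem surjective_algebraMap_end_of_quotSMulTop {y : R} (hy : y ∈ maximalIdeal R)
    (hreg : IsSMulRegular M y)
    (h : Function.Surjective (algebraMap R (Module.End R (QuotSMulTop y M)))) :
    Function.Surjective (algebraMap R (Module.End R M)) := by
  let H := LinearMap.range (Algebra.linearMap R (Module.End R M))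
  suffices ⊤ ≤ H from LinearMap.range_eq_top.mp (top_le_iff.mp this)
  refine Submodule.le_of_le_smul_of_le_jacobson_bot (I := maximalIdeal R)
    (IsNoetherian.noetherian _) (maximalIdeal_le_jacobson _) fun φ _ ↦ ?_
  obtain ⟨r, hr⟩ := h (QuotSMulTop.map y φ)
  have hrange (m : M) : (φ - algebraMap R _ r) m ∈ LinearMap.range (LinearMap.lsmul R M y) := by
    have hm := LinearMap.congr_fun hr (Submodule.Quotient.mk m)
    obtain ⟨v, -, hv⟩ := (Submodule.mem_smul_pointwise_iff_exists _ _ _).mp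
      ((Submodule.Quotient.eq _).mp hm.symm)
    exact ⟨v, hv⟩
  let ψ : Module.End R M := (LinearEquiv.ofInjective (LinearMap.lsmul R M y) hreg).symm ∘ₗ
    (φ - algebraMap R _ r).codRestrict _ hrange
  have hψ : φ = algebraMap R _ r + y • ψ := by
    ext m
    have : y • ψ m = (φ - algebraMap R _ r) m := congrArg Subtype.val
      ((LinearEquiv.ofInjective (LinearMap.lsmul R M y) hreg).apply_symm_apply ⟨_, hrange m⟩)
    simp [this]
  rw [hψ]
  exact Submodule.add_mem_sup ⟨r, rfl⟩ (Submodule.smul_mem_smul hy trivial)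

end Length

section HomothetyRing

open IsLocalRing

open scoped Pointwise

variable {R : Type u} [CommRing R] {M : Type u} [AddCommGroup M] [Module R M]
  {C : Type u} [AddCommGroup C] [Module R C] {f : R →ₗ[R] M} {g : M →ₗ[R] C}

/-- A map `C → M` composed with `g` is a homothety which kills `f 1`, hence it vanishes. -/
theorem subsingleton_linearMap_cokernel (hf : Function.Injective f) (hfg : Function.Exact f g)
    (hg : Function.Surjective g) (hM : Function.Surjective (algebraMap R (Module.End R M))) :
    Subsingleton (C →ₗ[R] M) := by
  refine subsingleton_of_forall_eq 0 fun ψ ↦ ?_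
  obtain ⟨r, hr⟩ := hM (ψ ∘ₗ g)
  have hfr : f r = 0 := by
    have : r • f 1 = ψ (g (f 1)) := LinearMap.congr_fun hr (f 1)
    rw [← mul_one r, ← smul_eq_mul, map_smul, this, hfg.apply_apply_eq_zero, map_zero]
  obtain rfl : r = 0 := hf (hfr.trans f.map_zero.symm)
  ext c
  obtain ⟨m, rfl⟩ := hg c
  simpa using (LinearMap.congr_fun hr m).symm

variable [IsLocalRing R] [IsNoetherianRing R] [Module.Finite R M]

theorem length_ext_quotSMulTop_le {n : ℕ} {y : R} (hy : IsSMulRegular M y)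
    (hM : (n + 1 : ℕ) ≤ depth R M) :
    Module.length R (Ext (ModuleCat.of R (ResidueField R))
      (ModuleCat.of R (QuotSMulTop y M)) n) ≤
    Module.length R (Ext (ModuleCat.of R (ResidueField R)) (ModuleCat.of R M) (n + 1)) := by
  have hS := shortExact_of_linearMap (f := LinearMap.lsmul R M y) hy
    (LinearMap.exact_lsmul_mkQ_smul_top M y) (Submodule.mkQ_surjective _)
  let δ := (Ext.bilinearCompOfLinear R (ModuleCat.of R (ResidueField R))
    (ModuleCat.of R (QuotSMulTop y M)) (ModuleCat.of R M) n 1 (n + 1) rfl).flip hS.extClass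
  refine Module.length_le_of_injective δ ((injective_iff_map_eq_zero δ).mpr fun x hx ↦ ?_)
  obtain ⟨z, rfl⟩ := Ext.covariant_sequence_exact₃ _ hS x rfl hx
  rw [(natCast_le_depth_iff.mp hM n n.lt_succ_self).elim z 0, Ext.zero_comp]

theorem surjective_algebraMap_end_of_length_ext_le_one {d : ℕ} (hdepth : d ≤ depth R M)
    (hdim : Module.supportDim R M ≤ d)
    (htype : Module.length R (Ext (ModuleCat.of R (ResidueField R)) (ModuleCat.of R M) d) ≤ 1) :
    Function.Surjective (algebraMap R (Module.End R M)) := by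
  induction d generalizing M with
  | zero =>
    refine surjective_algebraMap_end_of_length_ne_top ?_
      (length_ne_top_of_supportDim_le_zero (mod_cast hdim))
    rwa [← ((Ext.linearEquiv₀ (R := R) (X := ModuleCat.of R (ResidueField R))
      (Y := ModuleCat.of R M)).trans (ModuleCat.homLinearEquiv (S := R))).length_eq]
  | succ d ih =>
    obtain ⟨y, hy, hreg⟩ := exists_isSMulRegular_of_one_le_depth
      ((Nat.one_le_cast.mpr d.succ_pos).trans hdepth)
    refine surjective_algebraMap_end_of_quotSMulTop hy hreg (ih (le_depth_quotSMulTop hreg hdepth)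
      ?_ ((length_ext_quotSMulTop_le hreg hdepth).trans htype))
    rw [← Module.supportDim_quotSMulTop_succ_eq_supportDim hreg hy, Nat.cast_add,
      Nat.cast_one] at hdim
    exact ENat.WithBot.add_le_add_one_right_iff.mp hdim

theorem supportDim_cokernel_add_one_le [Nontrivial C] (hf : Function.Injective f)
    (hfg : Function.Exact f g) (hg : Function.Surjective g)
    (hM : Function.Surjective (algebraMap R (Module.End R M))) :
    Module.supportDim R C + 1 ≤ Module.supportDim R M := by
  have := Module.Finite.of_surjective g hg
  obtain ⟨x, hx, hreg⟩ := IsSMulRegular.subsingleton_linearMap_iff.mp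
    (subsingleton_linearMap_cokernel hf hfg hg hM)
  rw [Module.mem_annihilator] at hx
  have hxm : x ∈ maximalIdeal R := by
    refine (mem_maximalIdeal x).mpr fun hu ↦ ?_
    obtain ⟨c, hc⟩ := exists_ne (0 : C)
    exact hc (hu.smul_eq_zero.mp (hx c))
  rw [← Module.supportDim_quotSMulTop_succ_eq_supportDim hreg hxm]
  gcongr
  have hle : x • (⊤ : Submodule R M) ≤ LinearMap.ker g := by
    rintro _ ⟨m, -, rfl⟩
    simp [hx]
  exact Module.supportDim_le_of_surjective (Submodule.liftQ _ g hle) fun c ↦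
    (hg c).imp' (Submodule.Quotient.mk) fun _ ↦ id

theorem supportDim_cokernel_le_depth (hf : Function.Injective f) (hfg : Function.Exact f g)
    (hg : Function.Surjective g) {d : ℕ} (hR : d ≤ depth R R) (hdepth : d ≤ depth R M)
    (hdim : Module.supportDim R M ≤ d)
    (htype : Module.length R (Ext (ModuleCat.of R (ResidueField R)) (ModuleCat.of R M) d) ≤ 1) :
    Module.supportDim R C ≤ depth R C := by
  have := Module.Finite.of_surjective g hg
  rcases subsingleton_or_nontrivial C with hC | hC
  · simp [Module.supportDim_eq_bot_of_subsingleton]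
  have hle := (supportDim_cokernel_add_one_le hf hfg hg
    (surjective_algebraMap_end_of_length_ext_le_one hdepth hdim htype)).trans hdim
  rcases d with _ | d
  · obtain ⟨s, hs⟩ := WithBot.ne_bot_iff_exists.mp (Module.supportDim_ne_bot_of_nontrivial R C)
    rw [← hs] at hle
    have : s + 1 ≤ 0 := by exact_mod_cast hle
    simp at this
  · rw [Nat.cast_add, Nat.cast_one, ENat.WithBot.add_le_add_one_right_iff] at hle
    exact hle.trans (WithBot.coe_le_coe.mpr (le_depth_right_of_exact hf hfg hg hR
      ((Nat.cast_le.mpr d.le_succ).trans hdepth)))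

end HomothetyRing

section Superficial

open IsLocalRing PolynomialModule

variable {S : Type*} [CommRing S]

theorem smul_mem_pow_succ_smul {I : Ideal S} {C : Type*} [AddCommGroup C] [Module S C]
    {N : Submodule S C} {j : ℕ} {a : S} {v : C} (ha : a ∈ I) (hv : v ∈ I ^ j • N) :
    a • v ∈ I ^ (j + 1) • N := by
  rw [pow_succ', Submodule.mul_smul]
  exact Submodule.smul_mem_smul ha hv

theorem exists_notMem_of_finite [IsLocalRing S] [Infinite (ResidueField S)] {M : Type*}
    [AddCommGroup M] [Module S M] [Module.Finite S M] {𝒱 : Set (Submodule S M)} (h𝒱 : 𝒱.Finite)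
    (hne : ∀ V ∈ 𝒱, V ≠ ⊤) : ∃ v : M, ∀ V ∈ 𝒱, v ∉ V := by
  by_contra! hcover
  obtain ⟨V, hV, hfin⟩ := Submodule.exists_finiteIndex_of_cover (p := id) (s := h𝒱.toFinset)
    (Set.eq_univ_of_forall fun v ↦ by simpa using hcover v)
  have : V.toAddSubgroup.FiniteIndex := hfin
  have : Finite (M ⧸ V) := AddSubgroup.finite_quotient_of_finiteIndex (H := V.toAddSubgroup)
  have : Nontrivial (M ⧸ V) := Submodule.Quotient.nontrivial_iff.mpr (hne V (by simpa using hV))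
  let W := (M ⧸ V) ⧸ (maximalIdeal S • ⊤ : Submodule S (M ⧸ V))
  have : Nontrivial W := Submodule.Quotient.nontrivial_iff.mpr (maximalIdeal_smul_top_lt _).ne
  have : Finite W := Finite.of_surjective _ (Submodule.mkQ_surjective _)
  let _ : Module (ResidueField S) W :=
    Module.instQuotientIdealSubmoduleHSMulTop (M ⧸ V) (maximalIdeal S)
  have : Infinite W := Module.Free.infinite (ResidueField S) W
  exact not_finite W

/-- Each associated prime of `G` contains `t m` only for `m` in a proper submodule of `M`, and
finitely many proper submodules do not cover `M`. -/
theorem exists_isSMulRegular_of_forall_smul_eq_zero [IsLocalRing S] [Infinite (ResidueField S)]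
    {A : Type*} [CommRing A] [IsNoetherianRing A] [Algebra S A]
    {G : Type*} [AddCommGroup G] [Module A G] [Module.Finite A G]
    {M : Type*} [AddCommGroup M] [Module S M] [Module.Finite S M] (t : M →ₗ[S] A)
    (h : ∀ g : G, (∀ m, t m • g = 0) → g = 0) : ∃ m, IsSMulRegular G (t m) := by
  have hne : ∀ P ∈ associatedPrimes A G, (P.restrictScalars S).comap t ≠ ⊤ := by
    intro P hP htop
    obtain ⟨hprime, g, rfl⟩ := isAssociatedPrime_iff.mp hP
    obtain rfl := h g fun m ↦ by
      simpa [Submodule.mem_colon_singleton] using htop.ge (Submodule.mem_top (x := m))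
    exact hprime.ne_top (by ext; simp)
  obtain ⟨m, hm⟩ := exists_notMem_of_finite ((associatedPrimes.finite A G).image
    fun P ↦ (P.restrictScalars S).comap t) (by simpa using hne)
  refine ⟨m, isSMulRegular_iff_right_eq_zero_of_smul.mpr fun g hg ↦ ?_⟩
  by_contra hg0
  have : t m ∈ ⋃ P ∈ associatedPrimes A G, (P : Set A) := by
    rw [biUnion_associatedPrimes_eq_zero_divisors]
    exact ⟨g, hg0, hg⟩
  obtain ⟨P, hP, hmP⟩ := Set.mem_iUnion₂.mp this
  exact hm _ ⟨P, hP, rfl⟩ hmP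

variable (I : Ideal S) (C : Type*) [AddCommGroup C] [Module S C]

theorem exists_mem_pow_smul_of_forall_smul_mem [IsNoetherianRing S] [Module.Finite S C] :
    ∃ c, ∀ j ≥ c, ∀ v ∈ I ^ j • (⊤ : Submodule S C),
      (∀ a ∈ I, a • v ∈ I ^ (j + 2) • (⊤ : Submodule S C)) →
      v ∈ I ^ (j + 1) • (⊤ : Submodule S C) := by
  -- the filtration of the elements in question is stable, being contained in the `I`-adic one
  let Z : I.Filtration C :=
    { N j := I ^ j • ⊤ ⊓
        ⨅ a ∈ (I : Set S), (I ^ (j + 2) • ⊤ : Submodule S C).comap (LinearMap.lsmul S C a)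
      mono j v hv := by
        simp only [Submodule.mem_inf, Submodule.mem_iInf, Submodule.mem_comap] at hv ⊢
        exact ⟨Submodule.pow_smul_top_le I C j.le_succ hv.1,
          fun a ha ↦ smul_mem_pow_succ_smul ha hv.1⟩
      smul_le j := Submodule.smul_le.mpr fun r hr v hv ↦ by
        simp only [Submodule.mem_inf, Submodule.mem_iInf, Submodule.mem_comap] at hv ⊢
        exact ⟨smul_mem_pow_succ_smul hr hv.1, fun a ha ↦ smul_mem_pow_succ_smul ha (hv.2 r hr)⟩ }
  obtain ⟨n, hn⟩ := (I.stableFiltration_stable (⊤ : Submodule S C)).of_le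
    (show Z ≤ I.stableFiltration ⊤ from fun j ↦ inf_le_left)
  refine ⟨n + 1, fun j hj v hv h ↦ ?_⟩
  obtain ⟨j, rfl⟩ := Nat.exists_eq_add_of_le' (show 1 ≤ j by omega)
  have hZ : v ∈ Z.N (j + 1) := Submodule.mem_inf.mpr ⟨hv, by simpa using h⟩
  rw [← hn j (by omega)] at hZ
  refine Submodule.smul_le.mpr (fun r hr w hw ↦ ?_) hZ
  exact (Submodule.mem_iInf _).mp ((Submodule.mem_iInf _).mp hw.2 r) hr

/-- The element `a T` of degree one in the Rees algebra `⨁ Iⁿ Tⁿ`, for `a ∈ I`. -/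
noncomputable def reesMonomial : I →ₗ[S] reesAlgebra I :=
  ((Polynomial.monomial 1).comp I.subtype).codRestrict (Subalgebra.toSubmodule (reesAlgebra I))
    fun a ↦ reesAlgebra.monomial_mem.mpr (by simp)

/-- The module `⨁ₙ Iⁿ⁺ᶜ C` over the Rees algebra of `I`, a truncation of the Rees module of `C`
placed in degrees `n ≥ 0`. -/
noncomputable def truncatedRees (c : ℕ) : Submodule (reesAlgebra I) (PolynomialModule S C) :=
  (I.stableFiltration (I ^ c • (⊤ : Submodule S C))).submodule

variable {I C}

theorem mem_truncatedRees {c : ℕ} {f : PolynomialModule S C} :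
    f ∈ truncatedRees I C c ↔ ∀ n, f.coeff n ∈ I ^ (n + c) • (⊤ : Submodule S C) := by
  refine forall_congr' fun n ↦ ?_
  rw [pow_add, Submodule.mul_smul]; rfl

theorem single_mem_truncatedRees {c n : ℕ} {v : C} :
    single S n v ∈ truncatedRees I C c ↔ v ∈ I ^ (n + c) • (⊤ : Submodule S C) := by
  refine mem_truncatedRees.trans ⟨fun h ↦ by simpa using h n, fun h m ↦ ?_⟩
  rcases eq_or_ne n m with rfl | hm
  · simpa using h
  · simp [hm]

theorem coeff_reesMonomial_smul (a : I) (f : PolynomialModule S C) (n : ℕ) :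
    (reesMonomial I a • f).coeff (n + 1) = (a : S) • f.coeff n :=
  (monomial_smul_apply 1 (a : S) f (n + 1)).trans (by simp)

theorem reesMonomial_smul_single (a : I) (n : ℕ) (v : C) :
    reesMonomial I a • single S n v = single S (n + 1) ((a : S) • v) :=
  (monomial_smul_single 1 (a : S) n v).trans (by rw [add_comm])

variable (I C) in
/-- An element `y ∈ I` is superficial for `C` if `(Iⁿ⁺¹ C : y) ∩ Iᶜ C = Iⁿ C` for some `c` and all
`n ≥ c`; only the nontrivial inclusion is recorded. -/
def IsSuperficial (y : S) : Prop :=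
  y ∈ I ∧ ∃ c, ∀ n ≥ c, ∀ v ∈ I ^ c • (⊤ : Submodule S C),
    y • v ∈ I ^ (n + 1) • (⊤ : Submodule S C) → v ∈ I ^ n • (⊤ : Submodule S C)

theorem isSuperficial_of_graded {y : S} (hy : y ∈ I) {c : ℕ}
    (h : ∀ j ≥ c, ∀ v ∈ I ^ j • (⊤ : Submodule S C),
      y • v ∈ I ^ (j + 2) • (⊤ : Submodule S C) → v ∈ I ^ (j + 1) • (⊤ : Submodule S C)) :
    IsSuperficial I C y := by
  refine ⟨hy, c, fun n hn v hv ↦ ?_⟩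
  induction n, hn using Nat.le_induction with
  | base => exact fun _ ↦ hv
  | succ n hn ih =>
    exact fun hyv ↦ h n hn v (ih (Submodule.pow_smul_top_le I C (by omega) hyv)) hyv

variable [IsNoetherianRing S] [Module.Finite S C]

variable (I C) in
theorem exists_isSuperficial [IsLocalRing S] [Infinite (ResidueField S)] :
    ∃ y, IsSuperficial I C y := by
  obtain ⟨c, hc⟩ := exists_mem_pow_smul_of_forall_smul_mem I C
  let F := truncatedRees I C c
  let F' := truncatedRees I C (c + 1)
  let G := F.map F'.mkQ
  have : Module.Finite (reesAlgebra I) G := Module.Finite.iff_fg.mpr (Submodule.FG.map _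
    ((Ideal.Filtration.submodule_fg_iff_stable _ fun _ ↦ IsNoetherian.noetherian _).mpr
      (I.stableFiltration_stable _)))
  obtain ⟨y, hy⟩ := exists_isSMulRegular_of_forall_smul_eq_zero (G := G) (reesMonomial I) (by
    rintro ⟨_, f, hf, rfl⟩ h
    have h' (a : I) : reesMonomial I a • f ∈ F' :=
      (Submodule.Quotient.mk_eq_zero F').mp (congrArg Subtype.val (h a))
    refine Subtype.ext ((Submodule.Quotient.mk_eq_zero F').mpr (mem_truncatedRees.mpr fun n ↦ ?_))
    refine hc (n + c) (by omega) _ (mem_truncatedRees.mp hf n) fun a ha ↦ ?_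
    have := mem_truncatedRees.mp (h' ⟨a, ha⟩) (n + 1)
    rwa [coeff_reesMonomial_smul, show n + 1 + (c + 1) = n + c + 2 by omega] at this)
  refine ⟨y, isSuperficial_of_graded (c := c) y.2 fun j hj v hv hyv ↦ ?_⟩
  obtain ⟨n, rfl⟩ := Nat.exists_eq_add_of_le' hj
  let g : G := ⟨F'.mkQ (single S n v), _, single_mem_truncatedRees.mpr hv, rfl⟩
  have hg : g = 0 := by
    refine isSMulRegular_iff_right_eq_zero_of_smul.mp hy g
      (Subtype.ext ((Submodule.Quotient.mk_eq_zero F').mpr ?_))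
    change reesMonomial I y • single S n v ∈ F'
    rwa [reesMonomial_smul_single, single_mem_truncatedRees,
      show n + 1 + (c + 1) = n + c + 2 by omega]
  have := single_mem_truncatedRees.mp
    ((Submodule.Quotient.mk_eq_zero F').mp (congrArg Subtype.val hg))
  rwa [← add_assoc] at this

theorem IsSuperficial.isSMulRegular [IsLocalRing S] {x y : S} (hy : IsSuperficial I C y)
    (hI : I ≠ ⊤) (hx : x ∈ I) (hxreg : IsSMulRegular C x) : IsSMulRegular C y := by
  obtain ⟨-, c, hc⟩ := hy
  refine isSMulRegular_iff_right_eq_zero_of_smul.mpr fun z hz ↦ ?_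
  have hxz : x ^ c • z ∈ I ^ c • (⊤ : Submodule S C) :=
    Submodule.smul_mem_smul (Ideal.pow_mem_pow hx c) trivial
  have hinf : x ^ c • z ∈ ⨅ i, I ^ i • (⊤ : Submodule S C) := by
    refine (Submodule.mem_iInf _).mpr fun i ↦ Submodule.pow_smul_top_le I C (le_max_left i c)
      (hc _ (le_max_right i c) _ hxz ?_)
    rw [smul_comm, hz, smul_zero]
    exact zero_mem _
  rw [Ideal.iInf_pow_smul_eq_bot_of_isLocalRing I hI, Submodule.mem_bot] at hinf
  exact isSMulRegular_iff_right_eq_zero_of_smul.mp (hxreg.pow c) z hinf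

theorem IsSuperficial.exists_mem_pow_smul {y : S} (hy : IsSuperficial I C y)
    (hreg : IsSMulRegular C y) : ∃ n₀, ∀ n ≥ n₀, ∀ z : C,
      y • z ∈ I ^ (n + 1) • (⊤ : Submodule S C) → z ∈ I ^ n • (⊤ : Submodule S C) := by
  obtain ⟨-, c, hc⟩ := hy
  obtain ⟨k, hk⟩ := I.exists_pow_inf_eq_pow_smul (LinearMap.range (LinearMap.lsmul S C y))
  refine ⟨c + k, fun n hn z hz ↦ hc n (by omega) z ?_ hz⟩
  -- by Artin–Rees, `y z` lies in `y Iⁿ⁺¹⁻ᵏ C`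
  have hyz : y • z ∈ I ^ (n + 1) • (⊤ : Submodule S C) ⊓
    LinearMap.range (LinearMap.lsmul S C y) := ⟨hz, z, rfl⟩
  rw [hk _ (by omega)] at hyz
  have hmap := Submodule.smul_mono le_rfl inf_le_right hyz
  rw [← Submodule.map_top, ← Submodule.map_smul''] at hmap
  obtain ⟨w, hw, hwz⟩ := hmap
  rw [← hreg hwz]
  exact Submodule.pow_smul_top_le I C (by omega) hw

end Superficial

section ResidueExtension

open IsLocalRing Polynomial

theorem exists_flat_extension_infinite_residueField (S : Type u) [CommRing S] [IsLocalRing S]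
    [IsNoetherianRing S] :
    ∃ (S' : Type u) (_ : CommRing S') (_ : IsLocalRing S') (_ : Algebra S S'),
      IsNoetherianRing S' ∧ Module.Flat S S' ∧
        (maximalIdeal S).map (algebraMap S S') = maximalIdeal S' ∧ Infinite (ResidueField S') := by
  let P : Ideal S[X] := (maximalIdeal S).map C
  let S' := Localization.AtPrime P
  refine ⟨S', inferInstance, inferInstance, inferInstance,
    IsLocalization.isNoetherianRing P.primeCompl S' inferInstance, ?_, ?_, ?_⟩
  · have : Module.Flat S[X] S' := IsLocalization.flat S' P.primeCompl
    exact Module.Flat.trans S S[X] S'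
  · rw [IsScalarTower.algebraMap_eq S S[X] S', ← Ideal.map_map]
    exact Localization.AtPrime.map_eq_maximalIdeal
  · refine Infinite.of_injective (fun n : ℕ ↦ residue S' (algebraMap S[X] S' (X ^ n))) ?_
    intro m n hmn
    have hP : (X ^ m - X ^ n : S[X]) ∈ P := by
      rw [← IsLocalization.AtPrime.to_map_mem_maximal_iff S' P, map_sub]
      exact Ideal.Quotient.eq.mp hmn
    by_contra hne
    have := Ideal.mem_map_C_iff.mp hP m
    simp [coeff_X_pow, hne] at this

end ResidueExtension

section HilbertSamuel

open IsLocalRing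

open scoped TensorProduct

theorem length_quotient_eq_add_of_exact {R : Type*} [CommRing R] {A B C : Type*} [AddCommGroup A]
    [Module R A] [AddCommGroup B] [Module R B] [AddCommGroup C] [Module R C] {f : A →ₗ[R] B}
    {g : B →ₗ[R] C} (hfg : Function.Exact f g) (hg : Function.Surjective g) (N : Submodule R B) :
    Module.length R (B ⧸ N) =
      Module.length R (A ⧸ N.comap f) + Module.length R (C ⧸ N.map g) := by
  refine Module.length_eq_add_of_exact (Submodule.mapQ _ N f le_rfl)
    (Submodule.mapQ N _ g (Submodule.le_comap_map g N)) ?_ ?_ ?_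
  · rw [← LinearMap.ker_eq_bot, Submodule.mapQ, Submodule.ker_liftQ_eq_bot']
    rw [LinearMap.ker_comp, Submodule.ker_mkQ]
  · rw [← LinearMap.range_eq_top, Submodule.range_mapQ, LinearMap.range_eq_top.mpr hg,
      Submodule.map_top, Submodule.range_mkQ]
  · rw [LinearMap.exact_iff, Submodule.range_mapQ, Submodule.mapQ, Submodule.ker_liftQ,
      LinearMap.ker_comp, Submodule.ker_mkQ, Submodule.comap_map_eq, LinearMap.exact_iff.mp hfg,
      Submodule.map_sup]
    simp

/-- The Hilbert–Samuel function `j ↦ ℓ(C / 𝔪ʲ C)`, with the junk value `0` where the length is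
infinite. -/
noncomputable def hilbertSamuel (S : Type*) [CommRing S] [IsLocalRing S] (C : Type*)
    [AddCommGroup C] [Module S C] (j : ℕ) : ℕ :=
  (Module.length S (C ⧸ (maximalIdeal S ^ j • (⊤ : Submodule S C)))).toNat

variable {S : Type*} [CommRing S] [IsLocalRing S]

theorem hilbertSamuel_baseChange {S' : Type*} [CommRing S'] [IsLocalRing S'] [Algebra S S']
    [Module.Flat S S'] (h : (maximalIdeal S).map (algebraMap S S') = maximalIdeal S')
    (C : Type*) [AddCommGroup C] [Module S C] (j : ℕ) :
    hilbertSamuel S' (S' ⊗[S] C) j = hilbertSamuel S C j := by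
  have : IsLocalHom (algebraMap S S') :=
    ((local_hom_TFAE (algebraMap S S')).out 2 0).mp h.le
  have hk : Module.length S' (S' ⧸ maximalIdeal S') = 1 :=
    Module.length_eq_one_iff.mpr
      (isSimpleModule_iff_quot_maximal.mpr ⟨_, inferInstance, ⟨LinearEquiv.refl _ _⟩⟩)
  rw [hilbertSamuel, hilbertSamuel, ← h, ← Ideal.map_pow,
    (TensorProduct.tensorQuotMapSMulEquivTensorQuot C S' _).length_eq,
    length_baseChange, h, hk, mul_one]

theorem le_depth_baseChange {S' : Type*} [CommRing S'] [IsLocalRing S'] [Algebra S S']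
    [Module.Flat S S'] (h : (maximalIdeal S).map (algebraMap S S') ≤ maximalIdeal S')
    {C : Type*} [AddCommGroup C] [Module S C] {n : ℕ} (hn : n ≤ depth S C) :
    n ≤ depth S' (S' ⊗[S] C) := by
  obtain ⟨rs, hlen, hrs, hreg⟩ := natCast_le_depth_iff_exists.mp hn
  refine natCast_le_depth_iff_exists.mpr ⟨rs.map (algebraMap S S'), by simpa using hlen, ?_,
    hreg.of_flat_of_isBaseChange (TensorProduct.isBaseChange S C S')⟩
  intro r hr
  obtain ⟨t, ht, rfl⟩ := List.mem_map.mp hr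
  exact h (Ideal.mem_map_of_mem _ (hrs t ht))

variable [IsNoetherianRing S]

theorem length_quotient_maximalIdeal_pow_ne_top (C : Type*) [AddCommGroup C] [Module S C]
    [Module.Finite S C] (j : ℕ) :
    Module.length S (C ⧸ (maximalIdeal S ^ j • (⊤ : Submodule S C))) ≠ ⊤ := by
  rcases j with _ | j
  · simp [Module.length_eq_zero]
  · have : IsArtinianRing (S ⧸ maximalIdeal S ^ (j + 1)) :=
      quotient_artinian_of_mem_minimalPrimes_of_isLocalRing _ (by
        rw [← Ideal.radical_minimalPrimes, Ideal.radical_pow _ j.succ_ne_zero,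
          Ideal.IsPrime.radical inferInstance, Ideal.minimalPrimes_eq_subsingleton_self,
          Set.mem_singleton_iff])
    exact length_ne_top_of_isArtinianRing_quotient (maximalIdeal S ^ (j + 1)) _

theorem coe_hilbertSamuel (C : Type*) [AddCommGroup C] [Module S C] [Module.Finite S C] (j : ℕ) :
    (hilbertSamuel S C j : ℕ∞) =
      Module.length S (C ⧸ (maximalIdeal S ^ j • (⊤ : Submodule S C))) :=
  ENat.natCast_toNat (length_quotient_maximalIdeal_pow_ne_top C j)

theorem hilbertSamuel_mono (C : Type*) [AddCommGroup C] [Module S C] [Module.Finite S C] :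
    Monotone (hilbertSamuel S C) := fun i j hij ↦ by
  rw [← Nat.cast_le (α := ℕ∞), coe_hilbertSamuel, coe_hilbertSamuel]
  exact Module.length_le_of_surjective
    (Submodule.factor (Submodule.pow_smul_top_le _ _ hij)) (Submodule.factor_surjective _)

theorem hilbertSamuel_eq_add_of_exact {A B C : Type*} [AddCommGroup A] [Module S A]
    [AddCommGroup B] [Module S B] [Module.Finite S B] [AddCommGroup C] [Module S C]
    {f : A →ₗ[S] B} {g : B →ₗ[S] C} (hfg : Function.Exact f g) (hg : Function.Surjective g)
    (j : ℕ) :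
    (hilbertSamuel S B j : ℕ∞) =
      Module.length S (A ⧸ (maximalIdeal S ^ j • (⊤ : Submodule S B)).comap f) +
        hilbertSamuel S C j := by
  have := Module.Finite.of_surjective g hg
  rw [coe_hilbertSamuel, coe_hilbertSamuel, length_quotient_eq_add_of_exact hfg hg,
    Submodule.map_smul'', Submodule.map_top, LinearMap.range_eq_top.mpr hg]

theorem hilbertSamuel_one_eq_of_exact {A B C : Type*} [AddCommGroup A] [Module S A]
    [AddCommGroup B] [Module S B] [Module.Finite S B] [AddCommGroup C] [Module S C]
    {f : A →ₗ[S] B} {g : B →ₗ[S] C} (hfg : Function.Exact f g) (hg : Function.Surjective g)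
    (hf : ∀ a, f a ∈ maximalIdeal S • (⊤ : Submodule S B)) :
    hilbertSamuel S C 1 = hilbertSamuel S B 1 := by
  have htop : (maximalIdeal S ^ 1 • (⊤ : Submodule S B)).comap f = ⊤ := by
    rw [pow_one]; exact eq_top_iff.mpr fun a _ ↦ hf a
  rw [← Nat.cast_inj (R := ℕ∞), hilbertSamuel_eq_add_of_exact hfg hg, htop,
    Module.length_eq_zero, zero_add]

variable {C : Type*} [AddCommGroup C] [Module S C] [Module.Finite S C]

theorem hilbertSamuel_quotSMulTop_one {y : S} (hy : y ∈ maximalIdeal S) :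
    hilbertSamuel S (QuotSMulTop y C) 1 = hilbertSamuel S C 1 :=
  hilbertSamuel_one_eq_of_exact (LinearMap.exact_lsmul_mkQ_smul_top C y)
    (Submodule.mkQ_surjective _) fun _ ↦ Submodule.smul_mem_smul hy trivial

theorem hilbertSamuel_succ_eq_add {y : S} (hy : y ∈ maximalIdeal S) {j : ℕ}
    (h : ∀ z : C, y • z ∈ maximalIdeal S ^ (j + 1) • (⊤ : Submodule S C) →
      z ∈ maximalIdeal S ^ j • (⊤ : Submodule S C)) :
    hilbertSamuel S C (j + 1) =
      hilbertSamuel S C j + hilbertSamuel S (QuotSMulTop y C) (j + 1) := by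
  have hcomap : (maximalIdeal S ^ (j + 1) • (⊤ : Submodule S C)).comap (LinearMap.lsmul S C y) =
      maximalIdeal S ^ j • ⊤ := le_antisymm h fun z hz ↦ smul_mem_pow_succ_smul hy hz
  rw [← Nat.cast_inj (R := ℕ∞), hilbertSamuel_eq_add_of_exact
    (LinearMap.exact_lsmul_mkQ_smul_top C y) (Submodule.mkQ_surjective _), hcomap,
    ← coe_hilbertSamuel, Nat.cast_add]

theorem spanFinrank_eq_hilbertSamuel_one (S : Type*) [CommRing S] [IsLocalRing S]
    [IsNoetherianRing S] (C : Type*) [AddCommGroup C] [Module S C] [Module.Finite S C] :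
    (⊤ : Submodule S C).spanFinrank = hilbertSamuel S C 1 := by
  let _ : Field (S ⧸ maximalIdeal S) := Ideal.Quotient.field _
  let e : ((⊤ : Submodule S C) ⧸ (maximalIdeal S • (⊤ : Submodule S (⊤ : Submodule S C))))
      ≃ₗ[S] C ⧸ (maximalIdeal S ^ 1 • (⊤ : Submodule S C)) :=
    Submodule.Quotient.equiv _ _ Submodule.topEquiv (by
      rw [Submodule.map_smul'', Submodule.map_top, LinearEquiv.range, pow_one])
  have : Module.Finite (S ⧸ maximalIdeal S)
      ((⊤ : Submodule S C) ⧸ (maximalIdeal S • (⊤ : Submodule S (⊤ : Submodule S C)))) :=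
    Module.Finite.of_restrictScalars_finite S _ _
  rw [IsLocalRing.spanFinrank_eq_finrank_quotient _ Module.Finite.fg_top,
    ← Nat.cast_inj (R := ℕ∞), coe_hilbertSamuel, ← e.length_eq,
    Module.length_eq_of_surjective (R := S ⧸ maximalIdeal S) Ideal.Quotient.mk_surjective,
    Module.length_eq_finrank]

theorem exists_hilbertSamuel_succ_eq_add [Infinite (ResidueField S)] (h : 1 ≤ depth S C) :
    ∃ y ∈ maximalIdeal S, IsSMulRegular C y ∧ ∃ n₀, ∀ j ≥ n₀,
      hilbertSamuel S C (j + 1) =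
        hilbertSamuel S C j + hilbertSamuel S (QuotSMulTop y C) (j + 1) := by
  obtain ⟨x, hx, hxreg⟩ := exists_isSMulRegular_of_one_le_depth h
  obtain ⟨y, hy⟩ := exists_isSuperficial (maximalIdeal S) C
  have hyreg := hy.isSMulRegular (Ideal.IsPrime.ne_top inferInstance) hx hxreg
  obtain ⟨n₀, hn₀⟩ := hy.exists_mem_pow_smul hyreg
  exact ⟨y, hy.1, hyreg, n₀, fun j hj ↦ hilbertSamuel_succ_eq_add hy.1 (hn₀ j hj)⟩

theorem exists_mul_choose_le_of_succ_eq_add {f g : ℕ → ℕ} {n₀ : ℕ} (hg : Monotone g)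
    (h : ∀ j ≥ n₀, f (j + 1) = f j + g (j + 1)) {L c s : ℕ}
    (hL : ∀ j, L * j.choose s ≤ g (j + c)) : ∃ c', ∀ j, L * j.choose (s + 1) ≤ f (j + c') := by
  refine ⟨max n₀ c, fun j ↦ ?_⟩
  induction j with
  | zero => simp
  | succ j ih =>
    rw [add_right_comm, h _ (by omega), Nat.choose_succ_succ, mul_add, add_comm]
    exact add_le_add ih ((hL j).trans (hg (by omega)))

/-- Cutting by a superficial element, after enlarging the residue field, lowers the depth by one and
replaces the Hilbert–Samuel function by its first difference without changing its value at `1`. -/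
theorem exists_mul_choose_le_hilbertSamuel (s : ℕ) (S : Type u) [CommRing S] [IsLocalRing S]
    [IsNoetherianRing S] (C : Type u) [AddCommGroup C] [Module S C] [Module.Finite S C]
    (h : s ≤ depth S C) :
    ∃ c, ∀ j, hilbertSamuel S C 1 * j.choose s ≤ hilbertSamuel S C (j + c) := by
  induction s generalizing S C with
  | zero => exact ⟨1, fun j ↦ by simpa using hilbertSamuel_mono C (Nat.le_add_left 1 j)⟩
  | succ s ih =>
    obtain ⟨S', _, _, _, _, _, hm, _⟩ := exists_flat_extension_infinite_residueField S
    have hdepth := le_depth_baseChange hm.le h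
    obtain ⟨y, hy, hyreg, n₀, hn₀⟩ := exists_hilbertSamuel_succ_eq_add
      ((Nat.one_le_cast.mpr s.succ_pos).trans hdepth)
    obtain ⟨c, hc⟩ := ih S' (QuotSMulTop y (S' ⊗[S] C)) (le_depth_quotSMulTop hyreg hdepth)
    obtain ⟨c', hc'⟩ := exists_mul_choose_le_of_succ_eq_add (hilbertSamuel_mono _) hn₀ hc
    simp only [hilbertSamuel_quotSMulTop_one hy, hilbertSamuel_baseChange hm] at hc'
    exact ⟨c', hc'⟩

theorem le_of_tendsto_of_mul_choose_le {h : ℕ → ℕ} {s L c : ℕ} {e : ℝ}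
    (he : Tendsto (fun n : ℕ ↦ (s.factorial : ℝ) * (h n : ℝ) / (n : ℝ) ^ s) atTop (𝓝 e))
    (hL : ∀ j, L * j.choose s ≤ h (j + c)) : (L : ℝ) ≤ e := by
  have hlim : Tendsto (fun j : ℕ ↦ (L : ℝ) * ((j : ℝ) / (j + (s + c : ℕ))) ^ s) atTop (𝓝 L) := by
    simpa using ((tendsto_natCast_div_add_atTop ((s + c : ℕ) : ℝ)).pow s).const_mul (L : ℝ)
  refine le_of_tendsto_of_tendsto hlim (he.comp (tendsto_add_atTop_nat (s + c))) ?_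
  filter_upwards with j
  have hpow : L * j ^ s ≤ s.factorial * h (j + (s + c)) := calc
    L * j ^ s ≤ L * (j + s).descFactorial s := by
      refine Nat.mul_le_mul_left _ (le_trans (Nat.pow_le_pow_left ?_ s)
        (Nat.pow_sub_le_descFactorial (j + s) s))
      omega
    _ = s.factorial * (L * (j + s).choose s) := by
      rw [Nat.descFactorial_eq_factorial_mul_choose, mul_left_comm]
    _ ≤ s.factorial * h (j + (s + c)) := Nat.mul_le_mul_left _ (add_assoc j s c ▸ hL (j + s))
  rw [Function.comp_apply, div_pow, ← mul_div_assoc, Nat.cast_add j]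
  exact div_le_div_of_nonneg_right (by exact_mod_cast hpow) (by positivity)

end HilbertSamuel

section MinimalCover

open IsLocalRing

open scoped TensorProduct

variable {R : Type*} [CommRing R] {ι : Type*}

theorem mem_smul_top_pi [Finite ι] {I : Ideal R} {C : Type*}
    [AddCommGroup C] [Module R C] {v : ι → C} (hv : ∀ i, v i ∈ I • (⊤ : Submodule R C)) :
    v ∈ I • (⊤ : Submodule R (ι → C)) := by
  classical
  cases nonempty_fintype ι
  rw [← Finset.univ_sum_single v]
  refine Submodule.sum_mem _ fun i _ ↦ ?_
  have := Submodule.mem_map_of_mem (f := LinearMap.single R (fun _ : ι ↦ C) i) (hv i)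
  rw [Submodule.map_smul''] at this
  exact Submodule.smul_mono le_rfl le_top this

variable [IsLocalRing R]

theorem hilbertSamuel_pi [Fintype ι] (C : Type*) [AddCommGroup C] [Module R C] (j : ℕ) :
    hilbertSamuel R (ι → C) j = Fintype.card ι * hilbertSamuel R C j := by
  classical
  let e := (TensorProduct.quotTensorEquivQuotSMul (ι → C) (maximalIdeal R ^ j)).symm ≪≫ₗ
    TensorProduct.piRight R R (R ⧸ maximalIdeal R ^ j) (fun _ : ι ↦ C) ≪≫ₗ
    LinearEquiv.piCongrRight fun _ ↦ TensorProduct.quotTensorEquivQuotSMul C (maximalIdeal R ^ j)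
  rw [hilbertSamuel, e.length_eq, Module.length_pi, ENat.toNat_mul, ENat.card_eq_coe_fintype_card,
    ENat.toNat_natCast, hilbertSamuel]

theorem le_depth_pi [Finite ι] {C : Type*} [AddCommGroup C] [Module R C] {n : ℕ}
    (h : n ≤ depth R C) : n ≤ depth R (ι → C) := by
  classical
  cases nonempty_fintype ι
  obtain ⟨rs, hlen, hrs, hreg⟩ := natCast_le_depth_iff_exists.mp h
  let e : C ⊗[R] (ι → R) ≃ₗ[R] (ι → C) := TensorProduct.piScalarRight R R C ι
  exact natCast_le_depth_iff_exists.mpr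
    ⟨rs, hlen, hrs, (e.isWeaklyRegular_congr rs).mp hreg.isWeaklyRegular_rTensor⟩

variable (R) in
theorem exists_surjective_ker_le_maximalIdeal_smul_top [IsNoetherianRing R] (X : Type*)
    [AddCommGroup X] [Module R X] [Module.Finite R X] :
    ∃ (b : ℕ) (p : (Fin b → R) →ₗ[R] X), Function.Surjective p ∧
      LinearMap.ker p ≤ maximalIdeal R • (⊤ : Submodule R (Fin b → R)) := by
  obtain ⟨s, hcard, hspan⟩ :=
    (Module.Finite.fg_top (R := R) (M := X)).exists_span_finset_card_eq_spanFinrank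
  let p : (Fin s.card → R) →ₗ[R] X :=
    Fintype.linearCombination R (Subtype.val ∘ s.equivFin.symm)
  have hp : Function.Surjective p := by
    rw [← LinearMap.range_eq_top, Fintype.range_linearCombination, EquivLike.range_comp,
      Subtype.range_coe]
    exact hspan
  refine ⟨s.card, p, hp, ?_⟩
  have hdim : hilbertSamuel R (Fin s.card → R) 1 = hilbertSamuel R X 1 := by
    rw [← spanFinrank_eq_hilbertSamuel_one, ← spanFinrank_eq_hilbertSamuel_one, ← hcard,
      ← Module.finrank_eq_spanFinrank_of_free, Module.finrank_fin_fun]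
  have hlen := hilbertSamuel_eq_add_of_exact p.exact_subtype_ker_map hp 1
  have hzero := ENat.add_left_injective_of_ne_top (ENat.natCast_ne_top _)
    ((hdim ▸ hlen).symm.trans (zero_add _).symm)
  rw [Module.length_eq_zero_iff, Submodule.Quotient.subsingleton_iff, pow_one] at hzero
  exact fun x hx ↦ (hzero.ge (Submodule.mem_top (x := (⟨x, hx⟩ : LinearMap.ker p))) :)

end MinimalCover

section Hom

variable {R : Type u} [CommRing R] {X : Type u} [AddCommGroup X] [Module R X]
  {C : Type u} [AddCommGroup C] [Module R C] {b : ℕ}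

theorem ExtPosVanishes.exists_exact_linearMap (hX : ExtPosVanishes R X C)
    {p : (Fin b → R) →ₗ[R] X} (hp : Function.Surjective p) :
    ∃ (f : (X →ₗ[R] C) →ₗ[R] (Fin b → C)) (g : (Fin b → C) →ₗ[R] (LinearMap.ker p →ₗ[R] C)),
      Function.Injective f ∧ Function.Exact f g ∧ Function.Surjective g ∧
        ∀ φ i, f φ i = φ (p (Pi.single i 1)) := by
  let e := Module.piEquiv (Fin b) R C
  refine ⟨e.symm ∘ₗ p.lcomp R C, (LinearMap.ker p).subtype.lcomp R C ∘ₗ e,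
    e.symm.injective.comp (LinearMap.lcomp_injective_of_surjective p hp),
    (LinearEquiv.conj_exact_iff_exact _ _ e.symm).mpr
      (LinearMap.exact_lcomp_of_exact_of_surjective C p.exact_subtype_ker_map hp),
    Function.Surjective.comp (g := (LinearMap.ker p).subtype.lcomp R C)
      (fun φ ↦ hX.exists_extension hp φ) e.surjective, fun φ i ↦ ?_⟩
  have : e (fun i ↦ φ (p (Pi.single i 1))) = φ ∘ₗ p := by
    ext i; simp [e, Module.piEquiv_apply_apply, Pi.single_apply]
  exact congrFun (e.symm_apply_eq.mpr this.symm) i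

variable [IsLocalRing R] [IsNoetherianRing R] [Module.Finite R X] [Module.Finite R C]

theorem ExtPosVanishes.le_depth_linearMap (hX : ExtPosVanishes R X C) {n : ℕ}
    (hn : n ≤ depth R C) : n ≤ depth R (X →ₗ[R] C) := by
  induction n generalizing X with
  | zero => exact zero_le
  | succ n ih =>
    obtain ⟨b, p, hp⟩ := Module.Finite.exists_fin' R X
    obtain ⟨f, g, hf, hfg, hg, -⟩ := hX.exists_exact_linearMap hp
    exact le_depth_left_of_exact hf hfg hg (le_depth_pi hn)
      (ih (hX.ker hp) ((Nat.cast_le.mpr n.le_succ).trans hn))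

theorem subsingleton_of_forall_subsingleton_ext [Nontrivial C]
    (h : ∀ i, Subsingleton (Ext (ModuleCat.of R X) (ModuleCat.of R C) i)) : Subsingleton X := by
  by_contra hX
  have hlt : Module.annihilator R X • (⊤ : Submodule R C) < ⊤ :=
    (Submodule.smul_mono_left (IsLocalRing.le_maximalIdeal
      (mt Module.annihilator_eq_top_iff.mp hX))).trans_lt (maximalIdeal_smul_top_lt C)
  have hdim (n : ℕ) : n ≤ Module.supportDim R C := by
    obtain ⟨rs, rfl, -, hrs⟩ := ModuleCat.exists_isRegular_of_exists_subsingleton_ext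
      (Module.annihilator R X) n (ModuleCat.of R C) hlt (ModuleCat.of R X)
      Module.support_eq_zeroLocus fun i _ ↦ h i
    have := Submodule.Quotient.nontrivial_iff.mpr hrs.top_ne_smul.symm
    rw [← Module.supportDim_add_length_eq_supportDim_of_isRegular rs hrs]
    have := (Module.nonempty_support_of_nontrivial (R := R)
      (M := C ⧸ Ideal.ofList rs • (⊤ : Submodule R C))).to_subtype
    exact le_add_of_nonneg_left Order.krullDim_nonneg
  obtain ⟨d, hd⟩ := exists_ringKrullDim_eq_natCast R
  have := (hdim (d + 1)).trans (Module.supportDim_le_ringKrullDim R C)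
  rw [hd] at this
  exact absurd (by exact_mod_cast this) d.lt_succ_self.not_ge

end Hom

section Ulrich

open IsLocalRing

theorem exists_comap_pow_smul_le {R : Type*} [CommRing R] [IsNoetherianRing R] (I : Ideal R)
    {A B : Type*} [AddCommGroup A] [Module R A] [AddCommGroup B] [Module R B] [Module.Finite R B]
    {f : A →ₗ[R] B} (hf : Function.Injective f) :
    ∃ k, ∀ j, (I ^ (j + k) • (⊤ : Submodule R B)).comap f ≤ I ^ j • ⊤ := by
  obtain ⟨k, hk⟩ := I.exists_pow_inf_eq_pow_smul (LinearMap.range f)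
  refine ⟨k, fun j ↦ ?_⟩
  rw [← Submodule.map_le_map_iff_of_injective hf, Submodule.map_comap_eq, Submodule.map_smul'',
    Submodule.map_top, inf_comm, hk _ (Nat.le_add_left k j), Nat.add_sub_cancel]
  exact Submodule.smul_mono le_rfl inf_le_right

/-- An Ulrich module, possibly zero and of any dimension: a Cohen–Macaulay module whose multiplicity
is its minimal number of generators, the least value possible. -/
structure IsUlrich (R : Type*) [CommRing R] [IsLocalRing R] (C : Type*) [AddCommGroup C]
    [Module R C] : Prop where
  supportDim_le_depth : Module.supportDim R C ≤ depth R C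
  hasMultiplicity : HasMultiplicity R C ((⊤ : Submodule R C).spanFinrank : ℝ)

variable {R : Type u} [CommRing R] [IsNoetherianRing R] [IsLocalRing R]

theorem hilbertSamuel_one_add_le_of_exact {A B D : Type u} [AddCommGroup A] [Module R A]
    [Module.Finite R A] [AddCommGroup B] [Module R B] [Module.Finite R B] [AddCommGroup D]
    [Module R D] [Module.Finite R D] {f : A →ₗ[R] B} {g : B →ₗ[R] D} (hf : Function.Injective f)
    (hfg : Function.Exact f g) (hg : Function.Surjective g) {s : ℕ} (hA : s ≤ depth R A)
    (hD : s ≤ depth R D) {e : ℝ}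
    (he : Tendsto (fun n : ℕ ↦ (s.factorial : ℝ) * hilbertSamuel R B n / (n : ℝ) ^ s) atTop
      (𝓝 e)) :
    (hilbertSamuel R A 1 + hilbertSamuel R D 1 : ℕ) ≤ e := by
  obtain ⟨a, ha⟩ := exists_mul_choose_le_hilbertSamuel s R A hA
  obtain ⟨d, hd⟩ := exists_mul_choose_le_hilbertSamuel s R D hD
  obtain ⟨k, hk⟩ := exists_comap_pow_smul_le (maximalIdeal R) hf
  have hB (j : ℕ) :
      hilbertSamuel R A j + hilbertSamuel R D (j + k) ≤ hilbertSamuel R B (j + k) := by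
    rw [← Nat.cast_le (α := ℕ∞), hilbertSamuel_eq_add_of_exact hfg hg, Nat.cast_add,
      coe_hilbertSamuel]
    gcongr
    exact Module.length_le_of_surjective (Submodule.factor (hk j)) (Submodule.factor_surjective _)
  refine le_of_tendsto_of_mul_choose_le he (c := a + d + k) fun j ↦ ?_
  calc (hilbertSamuel R A 1 + hilbertSamuel R D 1) * j.choose s
      ≤ hilbertSamuel R A (j + a) + hilbertSamuel R D (j + d) :=
        (add_mul _ _ _).trans_le (add_le_add (ha j) (hd j))
    _ ≤ hilbertSamuel R A (j + a + d) + hilbertSamuel R D (j + a + d + k) :=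
        add_le_add (hilbertSamuel_mono A (by omega)) (hilbertSamuel_mono D (by omega))
    _ ≤ hilbertSamuel R B (j + (a + d + k)) := by
        simpa only [add_assoc] using hB (j + a + d)

variable {C : Type u} [AddCommGroup C] [Module R C] [Module.Finite R C]
  {X : Type u} [AddCommGroup X] [Module R X] [Module.Finite R X]

theorem IsUlrich.subsingleton_linearMap (hC : IsUlrich R C) (hX : ExtPosVanishes R X C)
    (h : ∀ (φ : X →ₗ[R] C) (x : X), φ x ∈ maximalIdeal R • (⊤ : Submodule R C)) :
    Subsingleton (X →ₗ[R] C) := by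
  obtain ⟨b, p, hp⟩ := Module.Finite.exists_fin' R X
  obtain ⟨f, g, hf, hfg, hg, hfapp⟩ := hX.exists_exact_linearMap hp
  have hone : hilbertSamuel R (LinearMap.ker p →ₗ[R] C) 1 = b * hilbertSamuel R C 1 := by
    rw [hilbertSamuel_one_eq_of_exact hfg hg fun φ ↦ mem_smul_top_pi fun i ↦ hfapp φ i ▸ h φ _,
      hilbertSamuel_pi, Fintype.card_fin]
  set s := ((Module.supportDim R C).unbotD 0).toNat
  have hdepth : (s : ℕ∞) ≤ depth R C :=
    (ENat.natCast_toNat_le_self _).trans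
      ((WithBot.unbotD_le_iff fun _ ↦ zero_le).mpr hC.supportDim_le_depth)
  have hlim : Tendsto (fun n : ℕ ↦ (s.factorial : ℝ) * hilbertSamuel R (Fin b → C) n / (n : ℝ) ^ s)
      atTop (𝓝 (b * hilbertSamuel R C 1 : ℕ)) := by
    have := hC.hasMultiplicity.const_mul (b : ℝ)
    rw [spanFinrank_eq_hilbertSamuel_one, ← Nat.cast_mul] at this
    refine this.congr fun n ↦ ?_
    rw [hilbertSamuel_pi, Fintype.card_fin, Nat.cast_mul, hilbertSamuel]
    ring
  have hle := hilbertSamuel_one_add_le_of_exact hf hfg hg (hX.le_depth_linearMap hdepth)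
    ((hX.ker hp).le_depth_linearMap hdepth) hlim
  rw [hone, Nat.cast_le, add_le_iff_nonpos_left, nonpos_iff_eq_zero,
    ← spanFinrank_eq_hilbertSamuel_one,
    Submodule.spanFinrank_eq_zero_iff_eq_bot Module.Finite.fg_top] at hle
  exact (Submodule.subsingleton_iff R).mp (subsingleton_of_bot_eq_top hle.symm)

/-- The syzygy `K` of `X` in a minimal cover satisfies `Hom(K, C) = 0`, because homomorphisms
`K → C` extend to the cover and therefore take values in `𝔪C`. -/
theorem IsUlrich.free_of_extPosVanishes [Nontrivial C] (hC : IsUlrich R C)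
    (hX : ExtPosVanishes R X C) : Module.Free R X := by
  obtain ⟨b, p, hp, hker⟩ := exists_surjective_ker_le_maximalIdeal_smul_top R X
  have hhom : Subsingleton (LinearMap.ker p →ₗ[R] C) := by
    refine hC.subsingleton_linearMap (hX.ker hp) fun φ x ↦ ?_
    obtain ⟨ψ, rfl⟩ := hX.exists_extension hp φ
    have := Submodule.mem_map_of_mem (f := ψ) (hker x.2)
    rw [Submodule.map_smul''] at this
    exact Submodule.smul_mono le_rfl le_top this
  have hzero : Subsingleton (LinearMap.ker p) := subsingleton_of_forall_subsingleton_ext fun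
    | 0 => (subsingleton_ext_zero_iff _ C).mpr hhom
    | i + 1 => hX.ker hp (i + 1) i.succ_pos
  have hinj : Function.Injective p :=
    LinearMap.ker_eq_bot.mp (Submodule.subsingleton_iff_eq_bot.mp hzero)
  exact Module.Free.of_equiv (LinearEquiv.ofBijective p ⟨hinj, hp⟩)

end Ulrich

section Descent

variable {R : Type u} [CommRing R] [IsLocalRing R] [IsNoetherianRing R]
  {X : Type u} [AddCommGroup X] [Module R X] [Module.Finite R X]

theorem free_of_free_ker {F : Type u} [AddCommGroup F] [Module R F] [Module.Free R F]
    [Module.Finite R F] (hX : Subsingleton (Ext (ModuleCat.of R X) (ModuleCat.of R R) 1))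
    {p : F →ₗ[R] X} (hp : Function.Surjective p) [Module.Free R (LinearMap.ker p)] :
    Module.Free R X := by
  let b := Module.Free.chooseBasis R (LinearMap.ker p)
  choose ψ hψ using fun j ↦ (subsingleton_ext_one_iff hp).mp hX (b.coord j)
  let l : F →ₗ[R] LinearMap.ker p := ∑ j, (ψ j).smulRight (b j)
  have hl : l ∘ₗ (LinearMap.ker p).subtype = LinearMap.id := by
    ext1 z
    have hz (j) : ψ j z = b.repr z j := LinearMap.congr_fun (hψ j) z
    simp [l, hz, b.sum_repr]
  obtain ⟨σ, hσ⟩ := ((p.exact_subtype_ker_map.split_tfae (Submodule.subtype_injective _) hp).out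
    1 0).mp (⟨l, hl⟩ : ∃ l, l ∘ₗ (LinearMap.ker p).subtype = LinearMap.id)
  have := Module.Projective.of_split σ p hσ
  exact Module.free_of_flat_of_isLocalRing

variable {C : Type u} [AddCommGroup C] [Module R C] [Module.Finite R C]

theorem IsUlrich.free_of_subsingleton_ext [Nontrivial C] (hC : IsUlrich R C)
    (hX : ExtPosVanishes R X R) (n : ℕ)
    (h : ∀ i > n, Subsingleton (Ext (ModuleCat.of R X) (ModuleCat.of R C) i)) :
    Module.Free R X := by
  induction n generalizing X with
  | zero => exact hC.free_of_extPosVanishes h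
  | succ n ih =>
    obtain ⟨b, p, hp⟩ := Module.Finite.exists_fin' R X
    have : Module.Free R (LinearMap.ker p) := ih (hX.ker hp) fun
      | i + 1, hi => (subsingleton_ext_add_two_iff hp i).mp (h (i + 2) (by omega))
    exact free_of_free_ker (hX 1 one_pos) hp

end Descent

section AlmostGorenstein

variable {R : Type u} [CommRing R]

theorem FiniteInjectiveDimension.of_linearEquiv {A B : Type u} [AddCommGroup A] [Module R A]
    [AddCommGroup B] [Module R B] (e : A ≃ₗ[R] B) (h : FiniteInjectiveDimension R B) :
    FiniteInjectiveDimension R A := by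
  obtain ⟨n, hn⟩ := h
  exact ⟨n, (Retract.ofIso e.toModuleIso).hasInjectiveDimensionLT n⟩

theorem nontrivial_cokernel_of_not_isGorenstein (hR : ¬ IsGorenstein R) {ω C : Type u}
    [AddCommGroup ω] [Module R ω] [AddCommGroup C] [Module R C] (hω : FiniteInjectiveDimension R ω)
    {f : R →ₗ[R] ω} {g : ω →ₗ[R] C} (hf : Function.Injective f) (hfg : Function.Exact f g) :
    Nontrivial C := by
  by_contra hC
  rw [not_nontrivial_iff_subsingleton] at hC
  exact hR (hω.of_linearEquiv
    (LinearEquiv.ofBijective f ⟨hf, fun w ↦ (hfg w).mp (Subsingleton.elim _ _)⟩))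

theorem IsCanonicalModule.supportDim_cokernel_le_depth [IsLocalRing R] [IsNoetherianRing R]
    (hR : IsCohenMacaulay R) {ω C : Type u} [AddCommGroup ω] [Module R ω] [AddCommGroup C]
    [Module R C] (hω : IsCanonicalModule R ω) {f : R →ₗ[R] ω} {g : ω →ₗ[R] C}
    (hf : Function.Injective f) (hfg : Function.Exact f g) (hg : Function.Surjective g) :
    Module.supportDim R C ≤ depth R C := by
  have := hω.finite
  obtain ⟨d, hd⟩ := exists_ringKrullDim_eq_natCast R
  have hdR : depth R R = d := by
    exact_mod_cast hR.trans hd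
  have hdω : depth R ω = d := by
    exact_mod_cast hω.maximalCohenMacaulay.trans hd
  have htype := hω.type_one
  rw [cmType, hdω, ENat.toNat_natCast] at htype
  exact LocalAlg.supportDim_cokernel_le_depth hf hfg hg hdR.ge hdω.ge
    (hd ▸ Module.supportDim_le_ringKrullDim R ω) htype.le

end AlmostGorenstein

end LocalAlg

theorem corollary4p6_general (R : Type u) [CommRing R] [IsNoetherianRing R] [IsLocalRing R]
    (hCM : LocalAlg.IsCohenMacaulay R) (hAG : LocalAlg.IsAlmostGorenstein R)
    (hnG : ¬ LocalAlg.IsGorenstein R)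
    (M : Type u) [AddCommGroup M] [Module R M] [Module.Finite R M]
    (hM : LocalAlg.ExtPosVanishes R M R) :
    Module.Free R M := by
  obtain ⟨ω, _, _, C, _, _, f, g, hω, hf, hfg, hg, hmult⟩ := hAG
  have := hω.finite
  have := Module.Finite.of_surjective g hg
  have := LocalAlg.nontrivial_cokernel_of_not_isGorenstein hnG hω.finiteInjectiveDimension hf hfg
  have hC : LocalAlg.IsUlrich R C := ⟨hω.supportDim_cokernel_le_depth hCM hf hfg hg, hmult⟩
  obtain ⟨n, hn⟩ := hω.finiteInjectiveDimension
  exact hC.free_of_subsingleton_ext hM n fun i hi ↦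
    LocalAlg.subsingleton_ext_right_of_exact hf hfg hg _ i
      (HasInjectiveDimensionLT.subsingleton _ n i hi.le _) (hM _ i.succ_pos)

theorem corollary4p6 (R : Type u) [CommRing R] [IsNoetherianRing R] [IsLocalRing R]
    (hCM : LocalAlg.IsCohenMacaulay R) (hAG : LocalAlg.IsAlmostGorenstein R)
    (hnG : ¬ LocalAlg.IsGorenstein R) (hES : LocalAlg.SatisfiesES R R 1)
    (M : Type u) [AddCommGroup M] [Module R M] [Module.Finite R M]
    (hM : LocalAlg.ExtPosVanishes R M R) :
    Module.Free R M :=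
  corollary4p6_general R hCM hAG hnG M hM
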